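/- Let $X$ (states) and $U$ (actions) be finite sets and let $P(x,u,x')$ be a transition kernel that is unichain: for every randomized stationary rule $\sigma(u|x)$ the Markov chain with transition matrix $P_\sigma(x,x')=\sum_u\sigma(u|x)P(x,u,x')$ has exactly one recurrent class. A policy $\pi$ may be randomized, history-dependent and non-stationary; it is stationary if it draws $U_t\sim\sigma(\cdot|X_t)$ for a fixed rule $\sigma$ at all times, and deterministic if $U_t=f(X_t)$ for a fixed $f:X\to U$. Let $\Pi,\Pi_S,\Pi_D$ be the sets of all, of stationary and of deterministic policies. For an initial distribution $\beta$ let $$\mu^t_{\beta,\pi}(x,u)=\frac1t\sum_{n=1}^t \mathsf P^\pi_\beta(X_n=x,U_n=u),$$ let $\Gamma^\pi_\beta\subset\mathbb R^{X\times U}$ be the set of all limits $\lim_n\mu^{t_n}_{\beta,\pi}$ with $t_n\to\infty$, and for a set $C$ of policies let $\Gamma^{C}_\beta=\bigcup_{\pi\in C}\Gamma^\pi_\beta$. Say that $\pi$ realizes $\mu$ if $\Gamma^\pi_\beta=\{\mu\}$ for every $\beta$. Let $\Phi$ be the set of all $\phi\in\mathbb R^{X\times U}$ with $\phi\ge0$,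 $\sum_{x,u}\phi(x,u)=1$ and $\sum_u\phi(x',u)=\sum_{x,u}\phi(x,u)P(x,u,x')$ for all $x'\in X$, and let $\phi(x)=\sum_u\phi(x,u)$. A vertex of $\Phi$ is a point that is not a proper convex combination of two distinct points of $\Phi$. Two distinct vertices are adjacent if some $|X||U|-1$ linearly independent constraints among those defining $\Phi$ are active at both. Then: (a) For every $\beta$, $\Gamma^{\Pi}_\beta=\Gamma^{\Pi_S}_\beta=\operatorname{conv}(\Gamma^{\Pi_D}_\beta)=\Phi$. For each $\mu\in\Gamma^\Pi_\beta$ there are stationary rules $\sigma$ with $\sigma(u|x)=\mu(x,u)/\mu(x)$ whenever $\mu(x)>0$ ($\sigma(\cdot|x)$ being arbitrary when $\mu(x)=0$), and every such rule realizes $\mu$. (b) For every $\beta$, the set of vertices of $\Phi$ is $\Gamma^{\Pi_D}_\beta$. (c) Any two adjacent vertices $\phi_1,\phi_2$ of $\Phi$ differ in exactly one state: they are realized by two deterministic policies $f_1,f_2$ that differ in exactly one state, and for any deterministic policies $f_1,f_2$ realizing $\phi_1,\phi_2$ there is exactly one state $x$ with $\phi_1(x)>0$, $\phi_2(x)>0$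 and $f_1(x)\ne f_2(x)$. (d) Every stationary rule $\sigma$ has a unique stationary distribution $\nu_\sigma$. Let $\phi_1,\phi_2$ be adjacent vertices of $\Phi$, realized by deterministic policies $f_1,f_2$ that differ in the state $i_0$ and in no other state, and let $b\in(0,1)$. Then $$\alpha=\frac{b\,\nu_{f_1}(i_0)}{b\,\nu_{f_1}(i_0)+(1-b)\,\nu_{f_2}(i_0)}$$ lies in $(0,1)$ with nonzero denominator, and the simple mixing policy $\alpha f_1+(1-\alpha)f_2$, the stationary policy that in state $i_0$ takes the action $f_1(i_0)$ with probability $\alpha$ and $f_2(i_0)$ with probability $1-\alpha$, and agrees with $f_1$ and $f_2$ in all other states, realizes the edge point $b\phi_1+(1-b)\phi_2$. -/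

import Mathlib

open Set Filter Topology

namespace OccupancyMDP

noncomputable section

/-- A transition kernel on finite state and action spaces: `P x u x'` is the probability of moving
from `x` to `x'` under the action `u`. -/
abbrev Kernel (X U : Type*) [Fintype X] := X → U → stdSimplex ℝ X

/-- An admissible policy, in general randomized, history dependent and non-stationary.
With time started at 1, `π n h x u` is the probability of the action `U_{n+1} = u` given that
`(X_1, U_1), …, (X_n, U_n)` are the entries of `h` and that `X_{n+1} = x`. -/
abbrev Policy (X U : Type*) [Fintype U] := (n : ℕ) → (Fin n → X × U) → X → stdSimplex ℝ U

/-- A randomized decision rule `σ x u = σ(u | x)`, used at all times by a stationary policy. -/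
abbrev StationaryRule (X U : Type*) [Fintype U] := X → stdSimplex ℝ U

variable {X U : Type*} [Fintype X] [Fintype U]

/-- The stationary policy that applies the rule `σ` at all times. -/
def StationaryRule.toPolicy (σ : StationaryRule X U) : Policy X U := fun _ _ x => σ x

open Classical in
/-- The rule that selects the action `f x` in state `x` with certainty. -/
def diracRule (f : X → U) : StationaryRule X U :=
  fun x => ⟨Pi.single (f x) 1, single_mem_stdSimplex ℝ (f x)⟩

/-- The deterministic (stationary) policy that selects the action `f x` in state `x`. -/
def deterministicPolicy (f : X → U) : Policy X U := (diracRule f).toPolicy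

variable (X U) in
/-- The set of stationary policies. -/
def stationaryPolicies : Set (Policy X U) := range StationaryRule.toPolicy

variable (X U) in
/-- The set of deterministic policies. -/
def deterministicPolicies : Set (Policy X U) := range deterministicPolicy

/-- `f₁` and `f₂` differ in the state `i₀` and in no other state. -/
def DifferExactlyAt (f₁ f₂ : X → U) (i₀ : X) : Prop :=
  f₁ i₀ ≠ f₂ i₀ ∧ ∀ x, x ≠ i₀ → f₁ x = f₂ x

/-- The mixture `α σ₁ + (1 - α) σ₂` of two stationary rules, for `0 < α < 1`. -/
def mix (α : ℝ) (hα : α ∈ Ioo (0 : ℝ) 1) (σ₁ σ₂ : StationaryRule X U) : StationaryRule X U :=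
  fun x => ⟨α • (σ₁ x).1 + (1 - α) • (σ₂ x).1,
    convex_stdSimplex ℝ U (σ₁ x).2 (σ₂ x).2 hα.1.le (sub_nonneg.2 hα.2.le) (by ring)⟩

/-! ### The controlled chain under a stationary policy -/

/-- The transition matrix `P_σ(x, x') = ∑ u, σ(u | x) P(x, u, x')`. -/
def transition (P : Kernel X U) (σ : StationaryRule X U) (x x' : X) : ℝ :=
  ∑ u, (σ x).1 u * (P x u).1 x'

/-- `y` is accessible from `x` (in zero or more steps of positive probability). -/
def Accessible (M : X → X → ℝ) : X → X → Prop := Relation.ReflTransGen fun x y => 0 < M x y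

/-- A recurrent class of a finite Markov chain: a nonempty set of states that is closed (nothing
else is accessible from it) and in which all states communicate. -/
def IsRecurrentClass (M : X → X → ℝ) (C : Set X) : Prop :=
  C.Nonempty ∧ ∀ x ∈ C, {y | Accessible M x y} = C

/-- The kernel is unichain: under every stationary policy (randomized ones included) the state
process is a Markov chain with a single recurrent class. -/
def Unichain (P : Kernel X U) : Prop :=
  ∀ σ : StationaryRule X U, ∃! C : Set X, IsRecurrentClass (transition P σ) C

/-- `ν` is a stationary distribution of the state process under the stationary rule `σ`. -/
def IsStationaryDistribution (P : Kernel X U) (σ : StationaryRule X U) (ν : stdSimplex ℝ X) :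
    Prop :=
  ∀ x', ν.1 x' = ∑ x, ν.1 x * transition P σ x x'

/-! ### Occupancy measures -/

/-- `historyProb P β π n h x` is the probability, under the policy `π` and the initial distribution
`β`, that `(X_1, U_1), …, (X_n, U_n)` are the entries of `h` and that `X_{n+1} = x`. -/
def historyProb (P : Kernel X U) (β : stdSimplex ℝ X) (π : Policy X U) :
    (n : ℕ) → (Fin n → X × U) → X → ℝ
  | 0, _, x => β.1 x
  | n + 1, h, x =>
      historyProb P β π n (Fin.init h) (h (Fin.last n)).1
        * (π n (Fin.init h) (h (Fin.last n)).1).1 (h (Fin.last n)).2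
        * (P (h (Fin.last n)).1 (h (Fin.last n)).2).1 x

/-- The probability that `X_{n+1} = x` and `U_{n+1} = u`. -/
def stateActionProb (P : Kernel X U) (β : stdSimplex ℝ X) (π : Policy X U) (n : ℕ)
    (p : X × U) : ℝ :=
  ∑ h : Fin n → X × U, historyProb P β π n h p.1 * (π n h p.1).1 p.2

/-- The finite-horizon occupancy measure
`μ^t(x, u) = (1 / t) * ∑_{n = 1}^t Prob(X_n = x, U_n = u)`. -/
def finiteOccupancy (P : Kernel X U) (β : stdSimplex ℝ X) (π : Policy X U) (t : ℕ) :
    X × U → ℝ :=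
  fun p => (1 / (t : ℝ)) * ∑ n ∈ Finset.range t, stateActionProb P β π n p

/-- The set of limiting occupancy measures of `π` from `β`: all subsequential limits of the
finite-horizon occupancy measures. -/
def occupancy (P : Kernel X U) (β : stdSimplex ℝ X) (π : Policy X U) : Set (X × U → ℝ) :=
  {μ | ∃ t : ℕ → ℕ, Tendsto t atTop atTop ∧
    Tendsto (fun n => finiteOccupancy P β π (t n)) atTop (𝓝 μ)}

/-- The limiting occupancy measures achievable from `β` by the policies in a given class. -/
def occupancySet (P : Kernel X U) (β : stdSimplex ℝ X) (C : Set (Policy X U)) :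
    Set (X × U → ℝ) :=
  ⋃ π ∈ C, occupancy P β π

/-- `π` realizes `φ`: from every initial distribution, `φ` is the only limiting occupancy measure
of `π`. -/
def Realizes (P : Kernel X U) (π : Policy X U) (φ : X × U → ℝ) : Prop :=
  ∀ β : stdSimplex ℝ X, occupancy P β π = {φ}

/-- The state marginal `φ(x) = ∑ u, φ(x, u)`. -/
def marginal (φ : X × U → ℝ) (x : X) : ℝ := ∑ u, φ (x, u)

/-- `σ(u | x) = μ(x, u) / μ(x)` wherever `μ(x) > 0`, while `σ(· | x)` is arbitrary elsewhere. -/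
def Recovers (σ : StationaryRule X U) (μ : X × U → ℝ) : Prop :=
  ∀ x, 0 < marginal μ x → ∀ u, (σ x).1 u = μ (x, u) / marginal μ x

/-! ### The polytope of the linear program -/

/-- The polytope `Φ`. -/
def polytope (P : Kernel X U) : Set (X × U → ℝ) :=
  {φ | (∀ x', ∑ u, φ (x', u) = ∑ x, ∑ u, φ (x, u) * (P x u).1 x') ∧
    ∑ x, ∑ u, φ (x, u) = 1 ∧ ∀ x u, 0 ≤ φ (x, u)}

/-- The vertices of the polytope `Φ`. -/
def vertices (P : Kernel X U) : Set (X × U → ℝ) := (polytope P).extremePoints ℝ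

variable (X U) in
/-- Names for the linear constraints that define `Φ`. -/
inductive Constraint where
  | balance (x' : X)
  | normalization
  | nonneg (x : X) (u : U)

open Classical in
/-- The coefficient vector of a constraint. -/
def Constraint.coeff (P : Kernel X U) : Constraint X U → X × U → ℝ
  | .balance x' => fun p => (if p.1 = x' then 1 else 0) - (P p.1 p.2).1 x'
  | .normalization => fun _ => 1
  | .nonneg x u => Pi.single (x, u) 1

/-- The right-hand side of a constraint. -/
def Constraint.rhs : Constraint X U → ℝ
  | .balance _ => 0
  | .normalization => 1
  | .nonneg _ _ => 0

/-- The constraint holds at `φ` with equality. -/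
def Constraint.Active (P : Kernel X U) (c : Constraint X U) (φ : X × U → ℝ) : Prop :=
  ∑ p, c.coeff P p * φ p = c.rhs

/-- `φ₁` and `φ₂` are adjacent vertices of `Φ`: they are distinct vertices at both of which a
common set of `|X| |U| - 1` linearly independent constraints is active. -/
def AdjacentVertices (P : Kernel X U) (φ₁ φ₂ : X × U → ℝ) : Prop :=
  φ₁ ∈ vertices P ∧ φ₂ ∈ vertices P ∧ φ₁ ≠ φ₂ ∧
    ∃ S : Finset (Constraint X U), S.card + 1 = Fintype.card X * Fintype.card U ∧
      (∀ c ∈ S, c.Active P φ₁ ∧ c.Active P φ₂) ∧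
      LinearIndependent ℝ fun c : S => c.1.coeff P

end

end OccupancyMDP

open OccupancyMDP

/-! The core is `mem_occupancy_toPolicy_iff`: the limiting occupancy measures of a stationary rule
`σ` are exactly the points of `Φ` that `σ` disintegrates. Balance holds in the limit because it
telescopes up to a boundary term of size `1/t`; limits exist by compactness. Uniqueness is where
unichain enters: the marginal is invariant under `P_σ`, and if two invariant vectors of equal mass
differed, the sets where their difference is positive and negative would be disjoint closed sets,
each containing a recurrent class (`invariant_eq_of_unique_recurrentClass`). Hence no ergodic
theorem is needed.

A deterministic rule cuts out a face of `Φ` that is a single point, hence a vertex. Conversely, a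
vertex is the only point of `Φ` supported inside its own support; choosing one charged action in
each charged state gives a chain that stays in the charged states, and its occupancy measure must be
that vertex (`exists_recovers_of_mem_vertices`). Convex hulls then follow from Krein–Milman.

Common active constraints of adjacent vertices cut out a line. If the two policies differed in two
states charged by both, a hybrid using the second policy in one and the first in the other would
give a point on that line whose parameter is both `1` and `0` (`AdjacentVertices.eq_of_ne_of_ne`).
The mixing formula is the conditional law of the edge point at `i₀`. -/

namespace OccupancyMDP

/-! ### Finite stochastic matrices -/

section Chain

variable {X : Type*} {M : X → X → ℝ}

/-- A set of states that the chain never leaves. -/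
def IsClosedSet (M : X → X → ℝ) (K : Set X) : Prop :=
  ∀ x ∈ K, ∀ y, 0 < M x y → y ∈ K

lemma IsClosedSet.mem_of_accessible {K : Set X} (hK : IsClosedSet M K) {x y : X} (hx : x ∈ K)
    (h : Accessible M x y) : y ∈ K := by
  induction h with
  | refl => exact hx
  | tail _ hbc ih => exact hK _ ih _ hbc

/-- Take a state of `K` with the fewest accessible states. Anything it reaches has an accessible set
that is contained in this one and no smaller, hence equal to it. -/
lemma IsClosedSet.exists_isRecurrentClass [Finite X] {K : Set X} (hK : IsClosedSet M K)
    (hne : K.Nonempty) : ∃ C ⊆ K, IsRecurrentClass M C := by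
  obtain ⟨x, hx, hmin⟩ := Set.exists_min_image K (fun x => {y | Accessible M x y}.ncard)
    (Set.toFinite K) hne
  refine ⟨{y | Accessible M x y}, fun y hy => hK.mem_of_accessible hx hy,
    ⟨x, Relation.ReflTransGen.refl⟩, fun y hy => ?_⟩
  exact Set.eq_of_subset_of_ncard_le (fun z hz => Relation.ReflTransGen.trans hy hz)
    (hmin y (hK.mem_of_accessible hx hy)) (Set.toFinite _)

variable [Fintype X]

/-- Nonnegativity of `M` gives `≤` pointwise; since `M` preserves total mass, both sides have the
same sum, so no inequality is strict. -/
lemma invariant_posPart (hM : ∀ x y, 0 ≤ M x y) (hM1 : ∀ x, ∑ y, M x y = 1) {d : X → ℝ}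
    (hd : ∀ y, d y = ∑ x, d x * M x y) (y : X) :
    max (d y) 0 = ∑ x, max (d x) 0 * M x y := by
  have hle : ∀ y ∈ Finset.univ, max (d y) 0 ≤ ∑ x, max (d x) 0 * M x y := fun y _ => by
    refine max_le ?_ (Finset.sum_nonneg fun x _ => mul_nonneg (le_max_right _ _) (hM x y))
    rw [hd y]
    exact Finset.sum_le_sum fun x _ => mul_le_mul_of_nonneg_right (le_max_left _ _) (hM x y)
  have hsum : ∑ y, max (d y) 0 = ∑ y, ∑ x, max (d x) 0 * M x y := by
    rw [Finset.sum_comm]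
    simp_rw [← Finset.mul_sum, hM1, mul_one]
  exact (Finset.sum_eq_sum_iff_of_le hle).1 hsum y (Finset.mem_univ y)

lemma isClosedSet_pos_of_invariant (hM : ∀ x y, 0 ≤ M x y) {d : X → ℝ} (h0 : ∀ x, 0 ≤ d x)
    (hd : ∀ y, d y = ∑ x, d x * M x y) : IsClosedSet M {x | 0 < d x} := by
  intro x hx y hxy
  rw [mem_ofPred_eq, hd y]
  exact (mul_pos hx hxy).trans_le (Finset.single_le_sum (f := fun x => d x * M x y)
    (fun x _ => mul_nonneg (h0 x) (hM x y)) (Finset.mem_univ x))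

lemma isClosedSet_pos_of_signed_invariant (hM : ∀ x y, 0 ≤ M x y) (hM1 : ∀ x, ∑ y, M x y = 1)
    {d : X → ℝ} (hd : ∀ y, d y = ∑ x, d x * M x y) : IsClosedSet M {x | 0 < d x} := by
  have h := isClosedSet_pos_of_invariant hM (fun x => le_max_right (d x) 0)
    (invariant_posPart hM hM1 hd)
  simpa using h

lemma invariant_eq_of_unique_recurrentClass (hM : ∀ x y, 0 ≤ M x y)
    (hM1 : ∀ x, ∑ y, M x y = 1) (hU : ∃! C : Set X, IsRecurrentClass M C) {v w : X → ℝ}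
    (hv : ∀ y, v y = ∑ x, v x * M x y) (hw : ∀ y, w y = ∑ x, w x * M x y)
    (hvw : ∑ x, v x = ∑ x, w x) : v = w := by
  have key : ∀ a b : X → ℝ, (∀ y, a y = ∑ x, a x * M x y) → (∀ y, b y = ∑ x, b x * M x y) →
      ∀ y, a y - b y = ∑ x, (a x - b x) * M x y := by
    intro a b ha hb y
    simp_rw [sub_mul, Finset.sum_sub_distrib, ← ha, ← hb]
  by_contra hne
  obtain ⟨x₁, hx₁⟩ : ∃ x, 0 < v x - w x := by
    by_contra! h
    exact hne (funext fun x => (Finset.sum_eq_sum_iff_of_le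
      (fun x _ => sub_nonpos.1 (h x))).1 hvw x (Finset.mem_univ x))
  obtain ⟨x₂, hx₂⟩ : ∃ x, 0 < w x - v x := by
    by_contra! h
    exact hne (funext fun x => ((Finset.sum_eq_sum_iff_of_le
      (fun x _ => sub_nonpos.1 (h x))).1 hvw.symm x (Finset.mem_univ x)).symm)
  obtain ⟨C₁, hC₁, h₁⟩ := (isClosedSet_pos_of_signed_invariant hM hM1
    (key v w hv hw)).exists_isRecurrentClass ⟨x₁, hx₁⟩
  obtain ⟨C₂, hC₂, h₂⟩ := (isClosedSet_pos_of_signed_invariant hM hM1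
    (key w v hw hv)).exists_isRecurrentClass ⟨x₂, hx₂⟩
  obtain rfl := hU.unique h₁ h₂
  obtain ⟨z, hz⟩ := h₁.1
  have hz₁ : 0 < v z - w z := hC₁ hz
  have hz₂ : 0 < w z - v z := hC₂ hz
  linarith

end Chain

/-! ### Deterministic rules -/

open Classical in
lemma diracRule_apply {X U : Type*} [Fintype U] (f : X → U) (x : X) (u : U) :
    (diracRule f x).1 u = if u = f x then 1 else 0 := by
  simp only [diracRule, Pi.single_apply]

open Classical in
/-- The actions outside the supports of the marginals can be chosen so that the two policies agree
there. -/
lemma exists_agreeing_policies {X U : Type*} [Fintype U] {φ₁ φ₂ : X × U → ℝ} {f₁ f₂ : X → U}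
    (hf₁ : Recovers (diracRule f₁) φ₁) (hf₂ : Recovers (diracRule f₂) φ₂) :
    ∃ g₁ g₂ : X → U, Recovers (diracRule g₁) φ₁ ∧ Recovers (diracRule g₂) φ₂ ∧
      ∀ x, g₁ x ≠ g₂ x ↔ 0 < marginal φ₁ x ∧ 0 < marginal φ₂ x ∧ f₁ x ≠ f₂ x := by
  -- Where only one marginal is positive, both new policies copy the policy it constrains; where
  -- neither is, both use `f₂`.
  refine ⟨fun x => if 0 < marginal φ₁ x then f₁ x else f₂ x,
    fun x => if 0 < marginal φ₁ x ∧ ¬ 0 < marginal φ₂ x then f₁ x else f₂ x, fun x hx u => ?_, fun x hx u => ?_,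
    fun x => ?_⟩
  · rw [← hf₁ x hx u, diracRule_apply, diracRule_apply, if_pos hx]
  · simp [← hf₂ x hx u, diracRule_apply, hx.not_ge]
  · by_cases hx₁ : 0 < marginal φ₁ x <;> by_cases hx₂ : 0 < marginal φ₂ x <;>
      simp [hx₁, hx₂]

/-! ### The chain under a stationary rule -/

variable {X U : Type*} [Fintype X] [Fintype U] {P : Kernel X U}

lemma transition_nonneg (P : Kernel X U) (σ : StationaryRule X U) (x y : X) :
    0 ≤ transition P σ x y :=
  Finset.sum_nonneg fun u _ => mul_nonneg ((σ x).2.1 u) ((P x u).2.1 y)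

lemma sum_transition (P : Kernel X U) (σ : StationaryRule X U) (x : X) :
    ∑ y, transition P σ x y = 1 := by
  unfold transition
  rw [Finset.sum_comm]
  simp_rw [← Finset.mul_sum, (P x _).2.2, mul_one, (σ x).2.2]

lemma transition_pos_iff {σ : StationaryRule X U} {x y : X} :
    0 < transition P σ x y ↔ ∃ u, 0 < (σ x).1 u ∧ 0 < (P x u).1 y := by
  unfold transition
  rw [Finset.sum_pos_iff_of_nonneg fun u _ => mul_nonneg ((σ x).2.1 u) ((P x u).2.1 y)]
  constructor
  · rintro ⟨u, -, hu⟩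
    exact ⟨u, pos_of_mul_pos_left hu ((P x u).2.1 y), pos_of_mul_pos_right hu ((σ x).2.1 u)⟩
  · rintro ⟨u, h₁, h₂⟩
    exact ⟨u, Finset.mem_univ u, mul_pos h₁ h₂⟩

lemma Unichain.nonempty_state (hP : Unichain P) (σ : StationaryRule X U) : Nonempty X := by
  obtain ⟨C, hC, -⟩ := hP σ
  exact hC.1.to_type

/-! ### State and action probabilities -/

/-- The probability that `X_{n+1} = x`. -/
noncomputable def stateProb (P : Kernel X U) (β : stdSimplex ℝ X) (π : Policy X U) (n : ℕ)
    (x : X) : ℝ :=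
  ∑ h : Fin n → X × U, historyProb P β π n h x

lemma historyProb_nonneg (P : Kernel X U) (β : stdSimplex ℝ X) (π : Policy X U) (n : ℕ)
    (h : Fin n → X × U) (x : X) : 0 ≤ historyProb P β π n h x := by
  induction n generalizing x with
  | zero => exact β.2.1 x
  | succ n ih =>
    exact mul_nonneg (mul_nonneg (ih _ _) ((π n _ _).2.1 _)) ((P _ _).2.1 x)

lemma stateProb_nonneg (P : Kernel X U) (β : stdSimplex ℝ X) (π : Policy X U) (n : ℕ) (x : X) :
    0 ≤ stateProb P β π n x :=
  Finset.sum_nonneg fun _ _ => historyProb_nonneg ..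

lemma stateActionProb_nonneg (P : Kernel X U) (β : stdSimplex ℝ X) (π : Policy X U) (n : ℕ)
    (p : X × U) : 0 ≤ stateActionProb P β π n p :=
  Finset.sum_nonneg fun _ _ => mul_nonneg (historyProb_nonneg ..) ((π _ _ _).2.1 _)

lemma sum_stateActionProb (P : Kernel X U) (β : stdSimplex ℝ X) (π : Policy X U) (n : ℕ)
    (x : X) : ∑ u, stateActionProb P β π n (x, u) = stateProb P β π n x := by
  unfold stateActionProb stateProb
  rw [Finset.sum_comm]
  simp_rw [← Finset.mul_sum, (π n _ x).2.2, mul_one]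

/-- Splitting off the last state-action pair sums out the earlier history, so even a
history-dependent policy enters only through the joint law of the current state and action. -/
lemma stateProb_succ (P : Kernel X U) (β : stdSimplex ℝ X) (π : Policy X U) (n : ℕ) (y : X) :
    stateProb P β π (n + 1) y = ∑ x, ∑ u, stateActionProb P β π n (x, u) * (P x u).1 y := by
  unfold stateProb stateActionProb
  rw [← Fintype.sum_prod_type'
      (f := fun x u => (∑ h, historyProb P β π n h x * (π n h x).1 u) * (P x u).1 y),
    ← (Fin.snocEquiv (fun _ => X × U)).sum_comp, Fintype.sum_prod_type]
  refine Finset.sum_congr rfl fun p _ => ?_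
  rw [Finset.sum_mul]
  refine Finset.sum_congr rfl fun h _ => ?_
  simp [historyProb, Fin.snocEquiv]

lemma sum_stateProb (P : Kernel X U) (β : stdSimplex ℝ X) (π : Policy X U) (n : ℕ) :
    ∑ x, stateProb P β π n x = 1 := by
  induction n with
  | zero => simpa [stateProb, historyProb] using β.2.2
  | succ n ih =>
    simp_rw [stateProb_succ]
    rw [Finset.sum_comm]
    have h : ∀ x, ∑ y, ∑ u, stateActionProb P β π n (x, u) * (P x u).1 y
        = stateProb P β π n x := fun x => by
      rw [Finset.sum_comm]
      simp_rw [← Finset.mul_sum, (P x _).2.2, mul_one, sum_stateActionProb]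
    simp_rw [h, ih]

lemma stateProb_le_one (P : Kernel X U) (β : stdSimplex ℝ X) (π : Policy X U) (n : ℕ) (x : X) :
    stateProb P β π n x ≤ 1 :=
  sum_stateProb P β π n ▸ Finset.single_le_sum (f := stateProb P β π n)
    (fun _ _ => stateProb_nonneg ..) (Finset.mem_univ x)

lemma stateActionProb_toPolicy (P : Kernel X U) (β : stdSimplex ℝ X) (σ : StationaryRule X U)
    (n : ℕ) (x : X) (u : U) :
    stateActionProb P β σ.toPolicy n (x, u) = stateProb P β σ.toPolicy n x * (σ x).1 u := by
  simp [stateActionProb, stateProb, StationaryRule.toPolicy, Finset.sum_mul]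

lemma stateProb_toPolicy_eq_zero {β : stdSimplex ℝ X} {σ : StationaryRule X U} {K : Set X}
    (hK : IsClosedSet (transition P σ) K) (hβ : ∀ x ∉ K, β.1 x = 0) (n : ℕ) {x : X}
    (hx : x ∉ K) : stateProb P β σ.toPolicy n x = 0 := by
  induction n generalizing x with
  | zero => simpa [stateProb, historyProb] using hβ x hx
  | succ n ih =>
    rw [stateProb_succ]
    refine Finset.sum_eq_zero fun y _ => Finset.sum_eq_zero fun u _ => ?_
    rw [stateActionProb_toPolicy]
    by_cases hy : y ∈ K
    · by_contra hne
      refine hx (hK y hy x (transition_pos_iff.2 ⟨u, ?_, ?_⟩))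
      · exact lt_of_le_of_ne ((σ y).2.1 u) fun h => hne (by simp [← h])
      · exact lt_of_le_of_ne ((P y u).2.1 x) fun h => hne (by simp [← h])
    · simp [ih hy]

/-! ### Occupancy measures -/

lemma finiteOccupancy_nonneg (P : Kernel X U) (β : stdSimplex ℝ X) (π : Policy X U) (t : ℕ)
    (p : X × U) : 0 ≤ finiteOccupancy P β π t p :=
  mul_nonneg (by positivity) (Finset.sum_nonneg fun _ _ => stateActionProb_nonneg ..)

lemma sum_finiteOccupancy (P : Kernel X U) (β : stdSimplex ℝ X) (π : Policy X U) {t : ℕ}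
    (ht : 0 < t) : ∑ x, ∑ u, finiteOccupancy P β π t (x, u) = 1 := by
  have ht' : (t : ℝ) ≠ 0 := by positivity
  have h : ∀ x, ∑ u, finiteOccupancy P β π t (x, u)
      = (1 / (t : ℝ)) * ∑ n ∈ Finset.range t, stateProb P β π n x := fun x => by
    unfold finiteOccupancy
    rw [← Finset.mul_sum, Finset.sum_comm]
    simp_rw [sum_stateActionProb]
  simp_rw [h]
  rw [← Finset.mul_sum, Finset.sum_comm]
  simp_rw [sum_stateProb]
  simp [ht']

lemma finiteOccupancy_balance (P : Kernel X U) (β : stdSimplex ℝ X) (π : Policy X U) (t : ℕ)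
    (y : X) :
    ∑ u, finiteOccupancy P β π t (y, u)
        - ∑ x, ∑ u, finiteOccupancy P β π t (x, u) * (P x u).1 y
      = (1 / (t : ℝ)) * (stateProb P β π 0 y - stateProb P β π t y) := by
  have h₁ : ∑ u, finiteOccupancy P β π t (y, u)
      = (1 / (t : ℝ)) * ∑ n ∈ Finset.range t, stateProb P β π n y := by
    unfold finiteOccupancy
    rw [← Finset.mul_sum, Finset.sum_comm]
    simp_rw [sum_stateActionProb]
  have h₂ : ∑ x, ∑ u, finiteOccupancy P β π t (x, u) * (P x u).1 y
      = (1 / (t : ℝ)) * ∑ n ∈ Finset.range t, stateProb P β π (n + 1) y := by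
    simp_rw [stateProb_succ]
    conv_rhs => rw [Finset.sum_comm, Finset.mul_sum]
    refine Finset.sum_congr rfl fun x _ => ?_
    conv_rhs => rw [Finset.sum_comm, Finset.mul_sum]
    refine Finset.sum_congr rfl fun u _ => ?_
    simp [finiteOccupancy, Finset.sum_mul, mul_assoc]
  rw [h₁, h₂, ← mul_sub, ← Finset.sum_sub_distrib,
    Finset.sum_range_sub' fun n => stateProb P β π n y]

lemma polytope_subset_stdSimplex (P : Kernel X U) : polytope P ⊆ stdSimplex ℝ (X × U) :=
  fun _ hφ => ⟨fun p => hφ.2.2 p.1 p.2, by rw [Fintype.sum_prod_type]; exact hφ.2.1⟩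

lemma isClosed_polytope (P : Kernel X U) : IsClosed (polytope P) := by
  have h : polytope P = (⋂ y, {φ | ∑ u, φ (y, u) = ∑ x, ∑ u, φ (x, u) * (P x u).1 y})
      ∩ ({φ | ∑ x, ∑ u, φ (x, u) = 1} ∩ ⋂ x, ⋂ u, {φ | 0 ≤ φ (x, u)}) := by
    ext φ
    simp [polytope]
  rw [h]
  exact (isClosed_iInter fun y => isClosed_eq (by fun_prop) (by fun_prop)).inter
    ((isClosed_eq (by fun_prop) (by fun_prop)).inter (isClosed_iInter fun x =>
      isClosed_iInter fun u => isClosed_le (by fun_prop) (by fun_prop)))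

lemma isCompact_polytope (P : Kernel X U) : IsCompact (polytope P) :=
  (isCompact_stdSimplex ℝ (X × U)).of_isClosed_subset (isClosed_polytope P)
    (polytope_subset_stdSimplex P)

lemma convex_polytope (P : Kernel X U) : Convex ℝ (polytope P) := by
  intro φ hφ ψ hψ a b ha hb hab
  refine ⟨fun y => ?_, ?_, fun x u => ?_⟩
  · simp only [Pi.add_apply, Pi.smul_apply, smul_eq_mul, add_mul, Finset.sum_add_distrib,
      mul_assoc, ← Finset.mul_sum, hφ.1 y, hψ.1 y]
  · simp only [Pi.add_apply, Pi.smul_apply, smul_eq_mul, Finset.sum_add_distrib,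
      ← Finset.mul_sum, hφ.2.1, hψ.2.1, mul_one, hab]
  · exact add_nonneg (mul_nonneg ha (hφ.2.2 x u)) (mul_nonneg hb (hψ.2.2 x u))

lemma occupancy_nonempty (P : Kernel X U) (β : stdSimplex ℝ X) (π : Policy X U) :
    (occupancy P β π).Nonempty := by
  obtain ⟨μ, -, s, hs, hμ⟩ := (isCompact_stdSimplex ℝ (X × U)).tendsto_subseq
    -- The horizon is shifted by one because at `t = 0` the occupancy is identically zero, not a
    -- probability vector.
    (x := fun n => finiteOccupancy P β π (n + 1)) fun n =>
      ⟨finiteOccupancy_nonneg P β π _, by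
        rw [Fintype.sum_prod_type]; exact sum_finiteOccupancy P β π n.succ_pos⟩
  exact ⟨μ, fun n => s n + 1, tendsto_atTop_mono (fun n => Nat.le_succ _) hs.tendsto_atTop, hμ⟩

lemma occupancy_subset_polytope (P : Kernel X U) (β : stdSimplex ℝ X) (π : Policy X U) :
    occupancy P β π ⊆ polytope P := by
  rintro μ ⟨t, ht, hμ⟩
  refine ⟨fun y => ?_, ?_, fun x u => ?_⟩
  · have h₁ : Tendsto (fun n => ∑ u, finiteOccupancy P β π (t n) (y, u)
        - ∑ x, ∑ u, finiteOccupancy P β π (t n) (x, u) * (P x u).1 y) atTop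
        (𝓝 (∑ u, μ (y, u) - ∑ x, ∑ u, μ (x, u) * (P x u).1 y)) := by
      have hc : Continuous fun φ : X × U → ℝ =>
          ∑ u, φ (y, u) - ∑ x, ∑ u, φ (x, u) * (P x u).1 y := by fun_prop
      exact (hc.tendsto μ).comp hμ
    have h₂ : Tendsto (fun n => (1 / (t n : ℝ))
        * (stateProb P β π 0 y - stateProb P β π (t n) y)) atTop (𝓝 0) := by
      refine squeeze_zero_norm (fun n => ?_) (tendsto_one_div_atTop_nhds_zero_nat.comp ht)
      have := stateProb_nonneg P β π 0 y
      have := stateProb_nonneg P β π (t n) y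
      have := stateProb_le_one P β π 0 y
      have := stateProb_le_one P β π (t n) y
      rw [norm_mul, Real.norm_of_nonneg (by positivity), Real.norm_eq_abs]
      exact mul_le_of_le_one_right (by positivity) (abs_le.2 ⟨by linarith, by linarith⟩)
    simp_rw [finiteOccupancy_balance] at h₁
    exact sub_eq_zero.1 (tendsto_nhds_unique h₁ h₂)
  · have hc : Continuous fun φ : X × U → ℝ => ∑ x, ∑ u, φ (x, u) := by fun_prop
    refine tendsto_nhds_unique ((hc.tendsto μ).comp hμ) (tendsto_const_nhds.congr' ?_)
    filter_upwards [ht.eventually_gt_atTop 0] with n hn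
    exact (sum_finiteOccupancy P β π hn).symm
  · exact ge_of_tendsto' (tendsto_pi_nhds.1 hμ (x, u)) fun n => finiteOccupancy_nonneg ..

/-! ### Stationary policies -/

lemma marginal_nonneg {φ : X × U → ℝ} (hφ : φ ∈ polytope P) (x : X) : 0 ≤ marginal φ x :=
  Finset.sum_nonneg fun u _ => hφ.2.2 x u

lemma le_marginal {φ : X × U → ℝ} (hφ : φ ∈ polytope P) (x : X) (u : U) :
    φ (x, u) ≤ marginal φ x :=
  Finset.single_le_sum (f := fun u => φ (x, u)) (fun u _ => hφ.2.2 x u) (Finset.mem_univ u)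

/-- The division-free form also covers states of zero marginal, where nonnegativity makes every
entry vanish. -/
lemma recovers_iff {σ : StationaryRule X U} {φ : X × U → ℝ} (hφ : φ ∈ polytope P) :
    Recovers σ φ ↔ ∀ x u, φ (x, u) = marginal φ x * (σ x).1 u := by
  constructor
  · intro h x u
    rcases (marginal_nonneg hφ x).eq_or_lt with h0 | hpos
    · rw [← h0, zero_mul]
      exact le_antisymm (h0 ▸ le_marginal hφ x u) (hφ.2.2 x u)
    · rw [h x hpos u, mul_div_cancel₀ _ hpos.ne']
  · intro h x hx u
    rw [h x u, mul_div_cancel_left₀ _ hx.ne']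

lemma marginal_invariant {σ : StationaryRule X U} {φ : X × U → ℝ} (hφ : φ ∈ polytope P)
    (h : Recovers σ φ) (y : X) : marginal φ y = ∑ x, marginal φ x * transition P σ x y := by
  rw [recovers_iff hφ] at h
  refine (hφ.1 y).trans (Finset.sum_congr rfl fun x _ => ?_)
  rw [transition, Finset.mul_sum]
  exact Finset.sum_congr rfl fun u _ => by rw [h x u, mul_assoc]

lemma isStationaryDistribution_unique (hP : Unichain P) {σ : StationaryRule X U}
    {ν ν' : stdSimplex ℝ X} (h : IsStationaryDistribution P σ ν)
    (h' : IsStationaryDistribution P σ ν') : ν = ν' :=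
  Subtype.ext (invariant_eq_of_unique_recurrentClass (transition_nonneg P σ)
    (sum_transition P σ) (hP σ) h h' (ν.2.2.trans ν'.2.2.symm))

lemma eq_of_recovers (hP : Unichain P) {σ : StationaryRule X U} {φ ψ : X × U → ℝ}
    (hφ : φ ∈ polytope P) (hψ : ψ ∈ polytope P) (h : Recovers σ φ) (h' : Recovers σ ψ) :
    φ = ψ := by
  have hm : marginal φ = marginal ψ := invariant_eq_of_unique_recurrentClass
    (transition_nonneg P σ) (sum_transition P σ) (hP σ) (marginal_invariant hφ h)
    (marginal_invariant hψ h') (hφ.2.1.trans hψ.2.1.symm)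
  ext ⟨x, u⟩
  rw [(recovers_iff hφ).1 h, (recovers_iff hψ).1 h', hm]

lemma marginal_eq_of_isStationaryDistribution (hP : Unichain P) {σ : StationaryRule X U}
    {φ : X × U → ℝ} (hφ : φ ∈ polytope P) (h : Recovers σ φ) {ν : stdSimplex ℝ X}
    (hν : IsStationaryDistribution P σ ν) : marginal φ = ν.1 :=
  invariant_eq_of_unique_recurrentClass (transition_nonneg P σ) (sum_transition P σ) (hP σ)
    (marginal_invariant hφ h) hν (hφ.2.1.trans ν.2.2.symm)

lemma recovers_of_mem_occupancy {β : stdSimplex ℝ X} {σ : StationaryRule X U} {φ : X × U → ℝ}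
    (hφ : φ ∈ occupancy P β σ.toPolicy) : Recovers σ φ := by
  rw [recovers_iff (occupancy_subset_polytope P β _ hφ)]
  obtain ⟨t, -, ht⟩ := hφ
  intro x u
  have hc : Continuous fun φ : X × U → ℝ => marginal φ x * (σ x).1 u := by
    unfold marginal; fun_prop
  refine tendsto_nhds_unique (tendsto_pi_nhds.1 ht (x, u)) (((hc.tendsto φ).comp ht).congr ?_)
  intro n
  simp only [Function.comp, marginal, finiteOccupancy, stateActionProb_toPolicy]
  rw [← Finset.mul_sum, Finset.sum_comm]
  simp_rw [← Finset.mul_sum, (σ x).2.2, mul_one, ← Finset.sum_mul, mul_assoc]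

lemma occupancy_toPolicy_eq (hP : Unichain P) {σ : StationaryRule X U} {φ : X × U → ℝ}
    (hφ : φ ∈ polytope P) (h : Recovers σ φ) (β : stdSimplex ℝ X) :
    occupancy P β σ.toPolicy = {φ} :=
  (occupancy_nonempty P β _).subset_singleton_iff.1 fun _ hψ =>
    eq_of_recovers hP (occupancy_subset_polytope P β _ hψ) hφ (recovers_of_mem_occupancy hψ) h

lemma mem_occupancy_toPolicy_iff (hP : Unichain P) {σ : StationaryRule X U} {φ : X × U → ℝ}
    {β : stdSimplex ℝ X} :
    φ ∈ occupancy P β σ.toPolicy ↔ φ ∈ polytope P ∧ Recovers σ φ :=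
  ⟨fun h => ⟨occupancy_subset_polytope P β _ h, recovers_of_mem_occupancy h⟩,
    fun h => (occupancy_toPolicy_eq hP h.1 h.2 β).symm ▸ mem_singleton φ⟩

/-- The point mass at a state. -/
noncomputable def pointMass (x : X) : stdSimplex ℝ X :=
  open Classical in ⟨Pi.single x 1, single_mem_stdSimplex ℝ x⟩

lemma realizes_toPolicy_iff (hP : Unichain P) {σ : StationaryRule X U} {φ : X × U → ℝ} :
    Realizes P σ.toPolicy φ ↔ φ ∈ polytope P ∧ Recovers σ φ := by
  refine ⟨fun h => ?_, fun h => occupancy_toPolicy_eq hP h.1 h.2⟩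
  -- `Realizes` quantifies over all `β`, so a state is needed to have some initial distribution to
  -- test.
  obtain ⟨x⟩ := hP.nonempty_state σ
  exact (mem_occupancy_toPolicy_iff hP (β := pointMass x)).1 ((h _).symm ▸ mem_singleton φ)

/-- Started inside `K`, the chain never leaves it, so every limiting occupancy measure vanishes off
`K`. This produces points of `Φ` with controlled support, for vertices and edges alike. -/
lemma exists_recovers_of_isClosedSet {σ : StationaryRule X U} {K : Set X}
    (hK : IsClosedSet (transition P σ) K) (hne : K.Nonempty) :
    ∃ φ ∈ polytope P, Recovers σ φ ∧ ∀ x ∉ K, ∀ u, φ (x, u) = 0 := by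
  obtain ⟨x₀, hx₀⟩ := hne
  obtain ⟨φ, hφ⟩ := occupancy_nonempty P (pointMass x₀) σ.toPolicy
  refine ⟨φ, occupancy_subset_polytope P _ _ hφ, recovers_of_mem_occupancy hφ, fun x hx u => ?_⟩
  obtain ⟨t, -, ht⟩ := hφ
  refine tendsto_nhds_unique (tendsto_pi_nhds.1 ht (x, u)) (tendsto_const_nhds.congr fun n => ?_)
  have hβ : ∀ y ∉ K, (pointMass x₀).1 y = 0 := fun y hy => by
    classical
    simp only [pointMass]
    exact Pi.single_eq_of_ne (fun h : y = x₀ => hy (h ▸ hx₀)) 1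
  simp [finiteOccupancy, stateActionProb_toPolicy, stateProb_toPolicy_eq_zero hK hβ _ hx]

lemma exists_recovers (hP : Unichain P) (σ : StationaryRule X U) :
    ∃ φ ∈ polytope P, Recovers σ φ := by
  obtain ⟨x⟩ := hP.nonempty_state σ
  obtain ⟨φ, h₁, h₂, -⟩ := exists_recovers_of_isClosedSet (P := P) (σ := σ) (K := univ)
    (fun _ _ _ _ => mem_univ _) ⟨x, mem_univ x⟩
  exact ⟨φ, h₁, h₂⟩

lemma existsUnique_isStationaryDistribution (hP : Unichain P) (σ : StationaryRule X U) :
    ∃! ν : stdSimplex ℝ X, IsStationaryDistribution P σ ν := by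
  obtain ⟨φ, hφ, h⟩ := exists_recovers hP σ
  exact ⟨⟨marginal φ, marginal_nonneg hφ, hφ.2.1⟩, marginal_invariant hφ h,
    fun ν hν => isStationaryDistribution_unique hP hν (marginal_invariant hφ h)⟩

lemma nonempty_action {φ : X × U → ℝ} (hφ : φ ∈ polytope P) : Nonempty U := by
  by_contra h
  rw [not_nonempty_iff] at h
  simpa using hφ.2.1

lemma exists_marginal_pos {φ : X × U → ℝ} (hφ : φ ∈ polytope P) : ∃ x, 0 < marginal φ x := by
  by_contra! h
  have : ∑ x, marginal φ x ≤ 0 := Finset.sum_nonpos fun x _ => h x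
  have : ∑ x, marginal φ x = 1 := hφ.2.1
  linarith

lemma exists_rule_recovers {φ : X × U → ℝ} (hφ : φ ∈ polytope P) :
    ∃ σ : StationaryRule X U, Recovers σ φ := by
  classical
  obtain ⟨u₀⟩ := nonempty_action hφ
  refine ⟨fun x => if h : 0 < marginal φ x then ⟨fun u => φ (x, u) / marginal φ x,
    fun u => div_nonneg (hφ.2.2 x u) h.le, ?_⟩ else pointMass u₀, fun x hx u => by simp [hx]⟩
  rw [← Finset.sum_div]
  exact div_self h.ne'

lemma occupancySet_univ (hP : Unichain P) (β : stdSimplex ℝ X) :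
    occupancySet P β univ = polytope P := by
  refine Subset.antisymm (iUnion₂_subset fun π _ => occupancy_subset_polytope P β π)
    fun φ hφ => ?_
  obtain ⟨σ, hσ⟩ := exists_rule_recovers hφ
  exact mem_iUnion₂.2 ⟨_, mem_univ _, (mem_occupancy_toPolicy_iff hP).2 ⟨hφ, hσ⟩⟩

lemma occupancySet_stationaryPolicies (hP : Unichain P) (β : stdSimplex ℝ X) :
    occupancySet P β (stationaryPolicies X U) = polytope P := by
  refine Subset.antisymm (iUnion₂_subset fun π _ => occupancy_subset_polytope P β π)
    fun φ hφ => ?_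
  obtain ⟨σ, hσ⟩ := exists_rule_recovers hφ
  exact mem_iUnion₂.2 ⟨_, mem_range_self σ, (mem_occupancy_toPolicy_iff hP).2 ⟨hφ, hσ⟩⟩

/-! ### Deterministic policies and vertices -/

lemma recovers_diracRule_iff {f : X → U} {φ : X × U → ℝ} (hφ : φ ∈ polytope P) :
    Recovers (diracRule f) φ ↔ ∀ x u, u ≠ f x → φ (x, u) = 0 := by
  classical
  rw [recovers_iff hφ]
  constructor
  · intro h x u hu
    rw [h x u, diracRule_apply, if_neg hu, mul_zero]
  · intro h x u
    rw [diracRule_apply]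
    split_ifs with hu
    · rw [mul_one, marginal, Finset.sum_eq_single (f x) (fun v _ hv => h x v hv) (by simp), hu]
    · rw [h x u hu, mul_zero]

lemma apply_eq_marginal {f : X → U} {φ : X × U → ℝ} (hφ : φ ∈ polytope P)
    (h : Recovers (diracRule f) φ) (x : X) : φ (x, f x) = marginal φ x := by
  classical
  rw [(recovers_iff hφ).1 h, diracRule_apply, if_pos rfl, mul_one]

lemma transition_diracRule (P : Kernel X U) (f : X → U) (x y : X) :
    transition P (diracRule f) x y = (P x (f x)).1 y := by
  classical
  simp [transition, diracRule_apply]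

lemma marginal_pos_of_pos {φ : X × U → ℝ} (hφ : φ ∈ polytope P) {x y : X} {u : U}
    (hx : 0 < φ (x, u)) (hxy : 0 < (P x u).1 y) : 0 < marginal φ y := by
  have hn : ∀ x u, 0 ≤ φ (x, u) * (P x u).1 y := fun x u =>
    mul_nonneg (hφ.2.2 x u) ((P x u).2.1 y)
  refine (mul_pos hx hxy).trans_le ?_
  refine (Finset.single_le_sum (f := fun u => φ (x, u) * (P x u).1 y) (fun u _ => hn x u)
    (Finset.mem_univ u)).trans ?_
  refine (Finset.single_le_sum (f := fun x => ∑ u, φ (x, u) * (P x u).1 y)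
    (fun x _ => Finset.sum_nonneg fun u _ => hn x u) (Finset.mem_univ x)).trans ?_
  exact (hφ.1 y).ge

/-- Zeros of `φ` are inherited by the endpoints of any segment in `Φ` around it, so these endpoints
are recovered by `f` too; uniqueness identifies them with `φ`. -/
lemma mem_vertices_of_recovers (hP : Unichain P) {f : X → U} {φ : X × U → ℝ}
    (hφ : φ ∈ polytope P) (h : Recovers (diracRule f) φ) : φ ∈ vertices P := by
  refine ⟨hφ, fun ψ₁ h₁ ψ₂ h₂ hseg => ?_⟩
  refine eq_of_recovers hP h₁ hφ ((recovers_diracRule_iff h₁).2 fun x u hu => ?_) h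
  obtain ⟨a, b, ha, hb, -, rfl⟩ := hseg
  have h0 := (recovers_diracRule_iff hφ).1 h x u hu
  simp only [Pi.add_apply, Pi.smul_apply, smul_eq_mul] at h0
  have := mul_nonneg ha.le (h₁.2.2 x u)
  have := mul_nonneg hb.le (h₂.2.2 x u)
  exact (mul_eq_zero.1 (by linarith : a * ψ₁ (x, u) = 0)).resolve_left ha.ne'

lemma exists_mul_le_of_support {ι : Type*} [Finite ι] {v w : ι → ℝ} (hv : ∀ i, 0 ≤ v i)
    (hw : ∀ i, 0 ≤ w i) (h : ∀ i, 0 < w i → 0 < v i) :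
    ∃ ε ∈ Ioo (0 : ℝ) 1, ∀ i, ε * w i ≤ v i := by
  have hev : ∀ i, ∀ᶠ ε in 𝓝[>] (0 : ℝ), ε * w i ≤ v i := fun i => by
    rcases (hw i).eq_or_lt with h0 | hpos
    · simp [← h0, hv i]
    · have hc : Tendsto (fun ε : ℝ => ε * w i) (𝓝[>] 0) (𝓝 0) := by
        have : Continuous fun ε : ℝ => ε * w i := by fun_prop
        simpa using (this.tendsto 0).mono_left nhdsWithin_le_nhds
      filter_upwards [hc.eventually_lt_const (h i hpos)] with ε hε using hε.le
  obtain ⟨ε, h₁, h₂⟩ := ((eventually_all.2 hev).and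
    (Ioo_mem_nhdsGT (zero_lt_one (α := ℝ)))).exists
  exact ⟨ε, h₂, h₁⟩

/-- A vertex is determined by its support among the points of the polytope. -/
lemma eq_of_mem_vertices_of_support {φ ψ : X × U → ℝ} (hφ : φ ∈ vertices P)
    (hψ : ψ ∈ polytope P) (h : ∀ p, 0 < ψ p → 0 < φ p) : ψ = φ := by
  obtain ⟨ε, ⟨h0, h1⟩, hε⟩ := exists_mul_le_of_support (fun p : X × U => hφ.1.2.2 p.1 p.2)
    (fun p => hψ.2.2 p.1 p.2) h
  have h1' : 0 < 1 - ε := by linarith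
  -- The renormalized remainder `χ` gives `φ = ε ψ + (1 - ε) χ`, to which extremality applies.
  have hχ : (1 - ε)⁻¹ • (φ - ε • ψ) ∈ polytope P := by
    refine ⟨fun y => ?_, ?_, fun x u => ?_⟩
    · simp only [Pi.sub_apply, Pi.smul_apply, smul_eq_mul, mul_assoc, ← Finset.mul_sum, sub_mul,
        Finset.sum_sub_distrib, hφ.1.1 y, hψ.1 y]
    · simp only [Pi.sub_apply, Pi.smul_apply, smul_eq_mul, ← Finset.mul_sum,
        Finset.sum_sub_distrib, hφ.1.2.1, hψ.2.1, mul_one]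
      exact inv_mul_cancel₀ h1'.ne'
    · exact mul_nonneg (by positivity) (sub_nonneg.2 (hε (x, u)))
  refine hφ.2 hψ hχ ⟨ε, 1 - ε, h0, h1', by ring, ?_⟩
  rw [smul_smul, mul_inv_cancel₀ h1'.ne', one_smul]
  abel

lemma exists_recovers_of_mem_vertices {φ : X × U → ℝ} (hφ : φ ∈ vertices P) :
    ∃ f : X → U, Recovers (diracRule f) φ := by
  -- In states of zero marginal the chosen action is arbitrary.
  have hf : ∀ x, ∃ u, 0 < marginal φ x → 0 < φ (x, u) := fun x => by
    by_contra! h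
    obtain ⟨u₀⟩ := nonempty_action hφ.1
    exact (h u₀).1.not_ge (Finset.sum_nonpos fun u _ => (h u).2)
  choose f hf using hf
  have hK : IsClosedSet (transition P (diracRule f)) {x | 0 < marginal φ x} := by
    intro x hx y hxy
    rw [transition_diracRule] at hxy
    exact marginal_pos_of_pos hφ.1 (hf x hx) hxy
  obtain ⟨ψ, hψ, hr, hs⟩ := exists_recovers_of_isClosedSet hK (exists_marginal_pos hφ.1)
  have : ψ = φ := eq_of_mem_vertices_of_support hφ hψ fun p hp => by
    obtain ⟨x, u⟩ := p
    have hx : 0 < marginal φ x := by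
      by_contra hx
      exact hp.ne' (hs x hx u)
    have hu : u = f x := by
      by_contra hu
      exact hp.ne' ((recovers_diracRule_iff hψ).1 hr x u hu)
    exact hu ▸ hf x hx
  exact ⟨f, this ▸ hr⟩

lemma vertices_eq_occupancySet (hP : Unichain P) (β : stdSimplex ℝ X) :
    vertices P = occupancySet P β (deterministicPolicies X U) := by
  ext φ
  simp only [occupancySet, deterministicPolicies, mem_iUnion, exists_prop, exists_range_iff,
    deterministicPolicy, mem_occupancy_toPolicy_iff hP]
  constructor
  · intro hφ
    obtain ⟨f, hf⟩ := exists_recovers_of_mem_vertices hφ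
    exact ⟨f, hφ.1, hf⟩
  · rintro ⟨f, hφ, hf⟩
    exact mem_vertices_of_recovers hP hφ hf

lemma finite_vertices (hP : Unichain P) : (vertices P).Finite := by
  have h : ∀ f : X → U, {φ | φ ∈ polytope P ∧ Recovers (diracRule f) φ}.Finite := fun f =>
    Set.Subsingleton.finite fun φ hφ ψ hψ => eq_of_recovers hP hφ.1 hψ.1 hφ.2 hψ.2
  refine (Set.finite_iUnion h).subset fun φ hφ => ?_
  obtain ⟨f, hf⟩ := exists_recovers_of_mem_vertices hφ
  exact mem_iUnion.2 ⟨f, hφ.1, hf⟩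

/-- Krein–Milman; the closure is superfluous since there are finitely many vertices. -/
lemma convexHull_vertices (hP : Unichain P) : convexHull ℝ (vertices P) = polytope P := by
  have h := closure_convexHull_extremePoints (isCompact_polytope P) (convex_polytope P)
  exact ((finite_vertices hP).isClosed_convexHull ℝ).closure_eq.symm.trans h

/-! ### Edges -/

/-- By rank-nullity the common kernel has dimension one. -/
lemma exists_smul_of_annihilated {ι κ : Type*} [Fintype ι] [Fintype κ] {c : κ → ι → ℝ}
    (hc : LinearIndependent ℝ c) (hcard : Fintype.card κ + 1 = Fintype.card ι) {v w : ι → ℝ}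
    (hv : v ≠ 0) (hcv : ∀ k, ∑ i, c k i * v i = 0) (hcw : ∀ k, ∑ i, c k i * w i = 0) :
    ∃ r : ℝ, r • v = w := by
  set A : Matrix κ ι ℝ := Matrix.of c
  have hker : Module.finrank ℝ A.mulVecLin.ker = 1 := by
    have h₁ : A.rank = Fintype.card κ := LinearIndependent.rank_matrix hc
    have h₂ := A.mulVecLin.finrank_range_add_finrank_ker
    rw [Module.finrank_fintype_fun_eq_card] at h₂
    unfold Matrix.rank at h₁
    omega
  have hv' : v ∈ A.mulVecLin.ker := funext hcv
  have hw' : w ∈ A.mulVecLin.ker := funext hcw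
  obtain ⟨r, hr⟩ := (finrank_eq_one_iff_of_nonzero' (⟨v, hv'⟩ : A.mulVecLin.ker)
    (fun h => hv (congrArg Subtype.val h))).1 hker ⟨w, hw'⟩
  exact ⟨r, congrArg Subtype.val hr⟩

lemma active_balance {φ : X × U → ℝ} (hφ : φ ∈ polytope P) (y : X) :
    (Constraint.balance y : Constraint X U).Active P φ := by
  classical
  simp only [Constraint.Active, Constraint.coeff, Constraint.rhs, Fintype.sum_prod_type, sub_mul,
    Finset.sum_sub_distrib, ite_mul, one_mul, zero_mul]
  rw [Finset.sum_comm]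
  simp only [Finset.sum_ite_eq', Finset.mem_univ, if_true, hφ.1 y, mul_comm, sub_self]

/-- A point of the polytope whose support lies in the union of the supports of two adjacent
vertices lies on the line through them. -/
lemma AdjacentVertices.exists_eq_lineMap {φ₁ φ₂ ψ : X × U → ℝ} (h : AdjacentVertices P φ₁ φ₂)
    (hψ : ψ ∈ polytope P) (hs : ∀ p, φ₁ p = 0 → φ₂ p = 0 → ψ p = 0) :
    ∃ r : ℝ, ∀ p, ψ p = φ₁ p + r * (φ₂ p - φ₁ p) := by
  classical
  obtain ⟨h₁, h₂, hne, S, hcard, hact, hli⟩ := h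
  -- The equality constraints hold on all of `Φ`; a nonnegativity constraint active at both vertices
  -- is active at `ψ` by `hs`.
  have hψact : ∀ c ∈ S, c.Active P ψ := by
    intro c hc
    have := hact c hc
    cases c with
    | balance y => exact active_balance hψ y
    | normalization =>
      simpa [Constraint.Active, Constraint.coeff, Constraint.rhs, Fintype.sum_prod_type]
        using hψ.2.1
    | nonneg x u =>
      simp only [Constraint.Active, Constraint.coeff, Constraint.rhs, Pi.single_apply, ite_mul,
        one_mul, zero_mul, Finset.sum_ite_eq', Finset.mem_univ, if_true] at this ⊢
      exact hs _ this.1 this.2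
  have hsub : ∀ φ : X × U → ℝ, (∀ c ∈ S, c.Active P φ) →
      ∀ c : S, ∑ p, c.1.coeff P p * (φ - φ₁) p = 0 := fun φ hφ c => by
    simp only [Pi.sub_apply, mul_sub, Finset.sum_sub_distrib]
    exact sub_eq_zero.2 ((hφ c c.2).trans (hact c c.2).1.symm)
  obtain ⟨r, hr⟩ := exists_smul_of_annihilated hli (by simpa using hcard)
    (sub_ne_zero.2 hne.symm) (hsub φ₂ fun c hc => (hact c hc).2) (hsub ψ hψact)
  refine ⟨r, fun p => ?_⟩
  have := congrFun hr p
  simp only [Pi.smul_apply, Pi.sub_apply, smul_eq_mul] at this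
  linarith

lemma AdjacentVertices.eq_of_ne_of_ne {φ₁ φ₂ : X × U → ℝ} {g₁ g₂ : X → U}
    (h : AdjacentVertices P φ₁ φ₂) (hg₁ : Recovers (diracRule g₁) φ₁)
    (hg₂ : Recovers (diracRule g₂) φ₂)
    (hg : ∀ x, g₁ x ≠ g₂ x → 0 < marginal φ₁ x ∧ 0 < marginal φ₂ x) {i j : X}
    (hi : g₁ i ≠ g₂ i) (hj : g₁ j ≠ g₂ j) : i = j := by
  classical
  by_contra hij
  have h₁ := h.1.1
  have h₂ := h.2.1.1
  -- The hybrid policy: it follows `g₂` at `i` and `g₁` at `j`.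
  set g : X → U := Function.update g₁ i (g₂ i)
  have hgi : g i = g₂ i := Function.update_self ..
  have hgj : g j = g₁ j := Function.update_of_ne (Ne.symm hij) ..
  have hsupp : ∀ x, 0 < marginal φ₁ x ∨ 0 < marginal φ₂ x →
      0 < φ₁ (x, g x) ∨ 0 < φ₂ (x, g x) := by
    intro x hx
    have hor : (0 < marginal φ₁ x ∧ g x = g₁ x) ∨ (0 < marginal φ₂ x ∧ g x = g₂ x) := by
      by_cases hxi : x = i
      · subst hxi
        exact Or.inr ⟨(hg x hi).2, hgi⟩
      · have hgx : g x = g₁ x := Function.update_of_ne hxi ..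
        by_cases hx₁ : 0 < marginal φ₁ x
        · exact Or.inl ⟨hx₁, hgx⟩
        · refine Or.inr ⟨hx.resolve_left hx₁, ?_⟩
          by_contra hne
          exact hx₁ (hg x (hgx ▸ hne)).1
    rcases hor with ⟨hp, he⟩ | ⟨hp, he⟩
    · exact Or.inl (by rwa [he, apply_eq_marginal h₁ hg₁])
    · exact Or.inr (by rwa [he, apply_eq_marginal h₂ hg₂])
  have hK : IsClosedSet (transition P (diracRule g))
      {x | 0 < marginal φ₁ x ∨ 0 < marginal φ₂ x} := by
    intro x hx y hxy
    rw [transition_diracRule] at hxy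
    exact (hsupp x hx).imp (marginal_pos_of_pos h₁ · hxy) (marginal_pos_of_pos h₂ · hxy)
  obtain ⟨ψ, hψ, hψg, hs⟩ := exists_recovers_of_isClosedSet hK
    ((exists_marginal_pos h₁).imp fun x => Or.inl)
  obtain ⟨r, hr⟩ := h.exists_eq_lineMap hψ fun p hp₁ hp₂ => by
    obtain ⟨x, u⟩ := p
    by_cases hx : x ∈ {x | 0 < marginal φ₁ x ∨ 0 < marginal φ₂ x}
    · refine (recovers_diracRule_iff hψ).1 hψg x u fun hu => ?_
      subst hu
      exact (hsupp x hx).elim (fun h => h.ne' hp₁) (fun h => h.ne' hp₂)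
    · exact hs x hx u
  have zero₁ := (recovers_diracRule_iff h₁).1 hg₁
  have zero₂ := (recovers_diracRule_iff h₂).1 hg₂
  have zero := (recovers_diracRule_iff hψ).1 hψg
  -- The hybrid avoids both `(i, g₁ i)` and `(j, g₂ j)`: the first equation forces `r = 1`, the
  -- second `r = 0`.
  have ei := hr (i, g₁ i)
  have ej := hr (j, g₂ j)
  rw [zero i _ (hgi ▸ hi), zero₂ i _ hi, apply_eq_marginal h₁ hg₁] at ei
  rw [zero j _ (hgj ▸ hj.symm), zero₁ j _ hj.symm, apply_eq_marginal h₂ hg₂] at ej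
  have hmi := (hg i hi).1.ne'
  have hmj := (hg j hj).2.ne'
  have r0 : r = 0 := (mul_eq_zero.1 (by linarith : r * marginal φ₂ j = 0)).resolve_right hmj
  subst r0
  exact hmi (by linarith)

lemma AdjacentVertices.existsUnique_ne (hP : Unichain P) {φ₁ φ₂ : X × U → ℝ} {f₁ f₂ : X → U}
    (h : AdjacentVertices P φ₁ φ₂) (hf₁ : Recovers (diracRule f₁) φ₁)
    (hf₂ : Recovers (diracRule f₂) φ₂) :
    ∃! x, 0 < marginal φ₁ x ∧ 0 < marginal φ₂ x ∧ f₁ x ≠ f₂ x := by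
  obtain ⟨g₁, g₂, hg₁, hg₂, hg⟩ := exists_agreeing_policies hf₁ hf₂
  have hne : ∃ x, g₁ x ≠ g₂ x := by
    by_contra! he
    obtain rfl := funext he
    exact h.2.2.1 (eq_of_recovers hP h.1.1 h.2.1.1 hg₁ hg₂)
  obtain ⟨x, hx⟩ := hne
  refine ⟨x, (hg x).1 hx, fun y hy => ?_⟩
  exact h.eq_of_ne_of_ne hg₁ hg₂ (fun z hz => ⟨((hg z).1 hz).1, ((hg z).1 hz).2.1⟩)
    ((hg y).2 hy) hx

lemma AdjacentVertices.exists_differExactlyAt (hP : Unichain P) {φ₁ φ₂ : X × U → ℝ}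
    (h : AdjacentVertices P φ₁ φ₂) :
    ∃ (f₁ f₂ : X → U) (i₀ : X), DifferExactlyAt f₁ f₂ i₀ ∧
      Recovers (diracRule f₁) φ₁ ∧ Recovers (diracRule f₂) φ₂ := by
  obtain ⟨f₁, hf₁⟩ := exists_recovers_of_mem_vertices h.1
  obtain ⟨f₂, hf₂⟩ := exists_recovers_of_mem_vertices h.2.1
  obtain ⟨g₁, g₂, hg₁, hg₂, hg⟩ := exists_agreeing_policies hf₁ hf₂
  obtain ⟨i₀, hi₀, huniq⟩ := h.existsUnique_ne hP hf₁ hf₂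
  refine ⟨g₁, g₂, i₀, ⟨(hg i₀).2 hi₀, fun x hx => ?_⟩, hg₁, hg₂⟩
  by_contra hne
  exact hx (huniq x ((hg x).1 hne))

/-- `hαb` is the formula for `α` cleared of its denominator. It is needed only at `i₀`; elsewhere
the two rules coincide and the identity is linear. -/
lemma recovers_mix {φ₁ φ₂ : X × U → ℝ} {f₁ f₂ : X → U} {i₀ : X} (h₁ : φ₁ ∈ polytope P)
    (h₂ : φ₂ ∈ polytope P) (hf₁ : Recovers (diracRule f₁) φ₁)
    (hf₂ : Recovers (diracRule f₂) φ₂) (hd : DifferExactlyAt f₁ f₂ i₀) {b α : ℝ}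
    (hb : b ∈ Ioo (0 : ℝ) 1) (hα : α ∈ Ioo (0 : ℝ) 1)
    (hαb : α * (b * marginal φ₁ i₀ + (1 - b) * marginal φ₂ i₀) = b * marginal φ₁ i₀) :
    Recovers (mix α hα (diracRule f₁) (diracRule f₂)) (b • φ₁ + (1 - b) • φ₂) := by
  have hmem : b • φ₁ + (1 - b) • φ₂ ∈ polytope P :=
    convex_polytope P h₁ h₂ hb.1.le (sub_nonneg.2 hb.2.le) (by ring)
  have hm : ∀ x, marginal (b • φ₁ + (1 - b) • φ₂) x
      = b * marginal φ₁ x + (1 - b) * marginal φ₂ x := fun x => by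
    simp [marginal, Finset.sum_add_distrib, Finset.mul_sum]
  rw [recovers_iff hmem]
  intro x u
  have e₁ := (recovers_iff h₁).1 hf₁ x u
  have e₂ := (recovers_iff h₂).1 hf₂ x u
  rw [hm]
  simp only [Pi.add_apply, Pi.smul_apply, smul_eq_mul, mix, e₁, e₂]
  by_cases hx : x = i₀
  · subst hx
    linear_combination ((diracRule f₂ x).1 u - (diracRule f₁ x).1 u) * hαb
  · have he : diracRule f₁ x = diracRule f₂ x := by
      simp only [diracRule, hd.2 x hx]
    rw [he]
    ring

end OccupancyMDP

theorem theorem1 {X U : Type*} [Fintype X] [Fintype U]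
    (P : OccupancyMDP.Kernel X U) (hP : Unichain P) :
    -- (a)
    (∀ β : stdSimplex ℝ X,
      occupancySet P β Set.univ = occupancySet P β (stationaryPolicies X U) ∧
      occupancySet P β (stationaryPolicies X U) =
        convexHull ℝ (occupancySet P β (deterministicPolicies X U)) ∧
      convexHull ℝ (occupancySet P β (deterministicPolicies X U)) = polytope P ∧
      ∀ μ ∈ occupancySet P β Set.univ,
        (∃ σ : StationaryRule X U, Recovers σ μ) ∧
        ∀ σ : StationaryRule X U, Recovers σ μ → Realizes P σ.toPolicy μ) ∧
    -- (b)
    (∀ β : stdSimplex ℝ X,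
      vertices P = occupancySet P β (deterministicPolicies X U)) ∧
    -- (c)
    (∀ φ₁ φ₂ : X × U → ℝ, AdjacentVertices P φ₁ φ₂ →
      (∃ (f₁ f₂ : X → U) (i₀ : X), DifferExactlyAt f₁ f₂ i₀ ∧
        Realizes P (deterministicPolicy f₁) φ₁ ∧ Realizes P (deterministicPolicy f₂) φ₂) ∧
      ∀ f₁ f₂ : X → U,
        Realizes P (deterministicPolicy f₁) φ₁ → Realizes P (deterministicPolicy f₂) φ₂ →
        ∃! x : X, 0 < marginal φ₁ x ∧ 0 < marginal φ₂ x ∧ f₁ x ≠ f₂ x) ∧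
    -- (d)
    (∀ σ : StationaryRule X U, ∃! ν : stdSimplex ℝ X, IsStationaryDistribution P σ ν) ∧
    (∀ φ₁ φ₂ : X × U → ℝ, AdjacentVertices P φ₁ φ₂ →
      ∀ (f₁ f₂ : X → U) (i₀ : X), DifferExactlyAt f₁ f₂ i₀ →
        Realizes P (deterministicPolicy f₁) φ₁ → Realizes P (deterministicPolicy f₂) φ₂ →
      ∀ ν₁ ν₂ : stdSimplex ℝ X,
        IsStationaryDistribution P (diracRule f₁) ν₁ →
        IsStationaryDistribution P (diracRule f₂) ν₂ →
      ∀ b ∈ Set.Ioo (0 : ℝ) 1,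
        ∃ hα : b * ν₁.1 i₀ / (b * ν₁.1 i₀ + (1 - b) * ν₂.1 i₀) ∈ Set.Ioo (0 : ℝ) 1,
          Realizes P
            (mix (b * ν₁.1 i₀ / (b * ν₁.1 i₀ + (1 - b) * ν₂.1 i₀)) hα
              (diracRule f₁) (diracRule f₂)).toPolicy
            (b • φ₁ + (1 - b) • φ₂)) := by
  have hdet : ∀ (f : X → U) (φ : X × U → ℝ), Realizes P (deterministicPolicy f) φ ↔
      φ ∈ polytope P ∧ Recovers (diracRule f) φ := fun f φ => realizes_toPolicy_iff hP
  refine ⟨fun β => ⟨?_, ?_, ?_, fun μ hμ => ?_⟩, vertices_eq_occupancySet hP,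
    fun φ₁ φ₂ h => ⟨?_, fun f₁ f₂ hf₁ hf₂ => ?_⟩, existsUnique_isStationaryDistribution hP,
    fun φ₁ φ₂ h f₁ f₂ i₀ hd hf₁ hf₂ ν₁ ν₂ hν₁ hν₂ b hb => ?_⟩
  · rw [occupancySet_univ hP, occupancySet_stationaryPolicies hP]
  · rw [occupancySet_stationaryPolicies hP, ← vertices_eq_occupancySet hP, convexHull_vertices hP]
  · rw [← vertices_eq_occupancySet hP, convexHull_vertices hP]
  · rw [occupancySet_univ hP] at hμ
    exact ⟨exists_rule_recovers hμ, fun σ hσ => (realizes_toPolicy_iff hP).2 ⟨hμ, hσ⟩⟩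
  · obtain ⟨f₁, f₂, i₀, hd, hf₁, hf₂⟩ := h.exists_differExactlyAt hP
    exact ⟨f₁, f₂, i₀, hd, (hdet _ _).2 ⟨h.1.1, hf₁⟩, (hdet _ _).2 ⟨h.2.1.1, hf₂⟩⟩
  · exact h.existsUnique_ne hP ((hdet _ _).1 hf₁).2 ((hdet _ _).1 hf₂).2
  · obtain ⟨h₁, hf₁⟩ := (hdet _ _).1 hf₁
    obtain ⟨h₂, hf₂⟩ := (hdet _ _).1 hf₂
    rw [← marginal_eq_of_isStationaryDistribution hP h₁ hf₁ hν₁,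
      ← marginal_eq_of_isStationaryDistribution hP h₂ hf₂ hν₂]
    -- The state from (c) must be `i₀`, so both marginals are positive there; this makes the
    -- denominator nonzero and puts `α` strictly between `0` and `1`.
    obtain ⟨x, ⟨hx₁, hx₂, hne⟩, -⟩ := h.existsUnique_ne hP hf₁ hf₂
    obtain rfl : x = i₀ := by
      by_contra hx
      exact hne (hd.2 x hx)
    have p₁ : 0 < b * marginal φ₁ x := mul_pos hb.1 hx₁
    have p₂ : 0 < (1 - b) * marginal φ₂ x := mul_pos (sub_pos.2 hb.2) hx₂
    have hα : b * marginal φ₁ x / (b * marginal φ₁ x + (1 - b) * marginal φ₂ x)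
        ∈ Set.Ioo (0 : ℝ) 1 :=
      ⟨by positivity, (div_lt_one (by positivity)).2 (by linarith)⟩
    exact ⟨hα, (realizes_toPolicy_iff hP).2
      ⟨convex_polytope P h₁ h₂ hb.1.le (sub_nonneg.2 hb.2.le) (by ring),
        recovers_mix h₁ h₂ hf₁ hf₂ hd hb hα (div_mul_cancel₀ _ (by positivity))⟩⟩
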